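/- For semigroups $S$ and $T$, write $S\prec T$ ("$S$ divides $T$") if $S$ is a homomorphic image of a subsemigroup of $T$. A finite semigroup $S$ is called $\times$-prime if, for all finite semigroups $T$ and $V$, $S\prec T\times V$ implies $S\prec T$ or $S\prec V$. Let $M=\mathcal{M}^0(\{1\},2,2;I_2)$ be the Rees matrix semigroup consisting of a zero $\theta$ and the elements $(1;i,j)$, $i,j\in\{1,2\}$, with $(1;i,j)(1;k,l)=(1;i,l)$ if $j=k$ and $\theta$ otherwise. Let $\{1,u\}$ be the cyclic group of order $2$, let $\{1,u,\theta\}$ be this group with a zero adjoined, and let $\Gamma$ be its representation by transformations of $\{1,2\}\cup\{\theta\}$ fixing $\theta$, in which $\Gamma(1)$ is the identity, $\Gamma(u)$ exchanges $1$ and $2$, and $\Gamma(\theta)$ is constantly $\theta$. Let $F_7=M\cup^{\Gamma}\{1,u,\theta\}$ be the $\theta$-disjoint union, that is, the disjoint union with the two zeros identified, whose multiplication extends those of $M$ and $\{1,u,\theta\}$ and satisfies, for $t\in\{1,u,\theta\}$, $(1;i,j)\,t=(1;i,\Gamma(t)(j))$ if $\Gamma(t)(j)\neq\theta$ and $\theta$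 otherwise, and $t\,(1;i,j)=(1;i',j)$ if $\Gamma(t)(i')=i$ for some $i'\in\{1,2\}$ and $\theta$ otherwise. **Theorem.** The semigroup $F_7$ has $7$ elements and is $\times$-prime. -/

import Mathlib

/-- The underlying set of the Rees matrix semigroup with zero `M⁰(G, n, m; P)`: a zero `θ` and
the triples `(g; i, j)`. The sandwich matrix `P` is an `m × n` matrix with entries in `G`
with a zero adjoined. -/
inductive ReesZero (G : Type) (n m : ℕ) (P : Matrix (Fin m) (Fin n) (WithZero G)) : Type
  | theta : ReesZero G n m P
  | elt (g : G) (i : Fin n) (j : Fin m) : ReesZero G n m P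

namespace ReesZero

variable {G : Type} {n m : ℕ} {P : Matrix (Fin m) (Fin n) (WithZero G)}

/-- The triple `(p; i, j)` with `p` in `G` with zero, read as `θ` when `p = 0`. -/
def ofEntry (p : WithZero G) (i : Fin n) (j : Fin m) : ReesZero G n m P :=
  WithZero.recZeroCoe (motive := fun _ => ReesZero G n m P) theta (fun g => elt g i j) p

@[simp] theorem ofEntry_zero (i : Fin n) (j : Fin m) :
    (ofEntry 0 i j : ReesZero G n m P) = theta := rfl

@[simp] theorem ofEntry_coe (g : G) (i : Fin n) (j : Fin m) :
    (ofEntry (g : WithZero G) i j : ReesZero G n m P) = elt g i j := rfl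

/-- `(g; i, j) (h; k, l) = (g p_{jk} h; i, l)`, which is `θ` when `p_{jk} = 0`. -/
def mul [Group G] : ReesZero G n m P → ReesZero G n m P → ReesZero G n m P
  | theta, _ => theta
  | elt _ _ _, theta => theta
  | elt g i j, elt h k l => ofEntry ((g : WithZero G) * P j k * (h : WithZero G)) i l

instance [Group G] : Mul (ReesZero G n m P) := ⟨mul⟩

section

variable [Group G]

@[simp] theorem theta_mul (x : ReesZero G n m P) : theta * x = theta := rfl

@[simp] theorem mul_theta (x : ReesZero G n m P) : x * theta = theta := by cases x <;> rfl

theorem elt_mul_elt (g h : G) (i k : Fin n) (j l : Fin m) :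
    (elt g i j : ReesZero G n m P) * elt h k l =
      ofEntry ((g : WithZero G) * P j k * (h : WithZero G)) i l := rfl

theorem ofEntry_mul_elt (p : WithZero G) (h : G) (i k : Fin n) (j l : Fin m) :
    (ofEntry p i j : ReesZero G n m P) * elt h k l = ofEntry (p * P j k * (h : WithZero G)) i l := by
  induction p with
  | zero => simp
  | coe g => rfl

theorem elt_mul_ofEntry (p : WithZero G) (g : G) (i k : Fin n) (j l : Fin m) :
    (elt g i j : ReesZero G n m P) * ofEntry p k l = ofEntry ((g : WithZero G) * P j k * p) i l := by
  induction p with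
  | zero => simp
  | coe g => rfl

end

instance [Group G] : Semigroup (ReesZero G n m P) where
  mul_assoc x y z := by
    rcases x with _ | ⟨g, i, j⟩
    · simp
    rcases y with _ | ⟨h, k, l⟩
    · simp
    rcases z with _ | ⟨f, a, b⟩
    · simp
    rw [elt_mul_elt, elt_mul_elt, ofEntry_mul_elt, elt_mul_ofEntry]
    simp only [mul_assoc]

end ReesZero

/-- The inverse semigroup `M⁰({1}, n, n; Iₙ)`, with the `n × n` identity matrix as its
sandwich matrix. -/
abbrev BrandtZero (n : ℕ) : Type := ReesZero Unit n n 1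

/-- A representation `Δ` of a semigroup `T` with zero in the full transformation semigroup on
`{1, …, n} ∪ {θ}` (`none` stands for `θ`), as it is used to form a `θ`-disjoint union.
Transformations act on the right: `Δ (s t)` is `Δ s` followed by `Δ t`. -/
structure ThetaRep (T : Type) [SemigroupWithZero T] (n : ℕ) where
  toFun : T → Option (Fin n) → Option (Fin n)
  map_mul : ∀ s t x, toFun (s * t) x = toFun t (toFun s x)
  map_theta : ∀ t, toFun t none = none
  eq_zero_iff : ∀ t, (∀ x, toFun t x = none) ↔ t = 0
  inj : ∀ t x y, toFun t x ≠ none → toFun t x = toFun t y → x = y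

namespace ThetaRep

variable {T : Type} [SemigroupWithZero T] {n : ℕ}

/-- The index `i'` with `Δ(t)(i') = i`, or `none` if there is none. -/
def preimage (Δ : ThetaRep T n) (t : T) (i : Fin n) : Option (Fin n) :=
  (List.finRange n).find? fun i' => decide (Δ.toFun t (some i') = some i)

theorem preimage_eq_some (Δ : ThetaRep T n) (t : T) (i i' : Fin n) :
    Δ.preimage t i = some i' ↔ Δ.toFun t (some i') = some i := by
  constructor
  · intro h
    simpa using List.find?_some h
  · intro h
    cases h' : Δ.preimage t i with
    | none =>
      have := List.find?_eq_none.1 h' i' (List.mem_finRange i')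
      simp [h] at this
    | some k =>
      have hk : Δ.toFun t (some k) = some i := by simpa using List.find?_some h'
      exact Δ.inj t _ _ (by simp [hk]) (hk.trans h.symm)

end ThetaRep

/-- The underlying set of the `θ`-disjoint union `M ∪^Δ T` of `M = M⁰({1}, n, n; Iₙ)` and `T`:
the disjoint union of `M` and `T` with the two zeros identified, so that `θ` is the zero of `M`
and only the nonzero elements of `T` are added. -/
inductive ThetaUnion {T : Type} [SemigroupWithZero T] {n : ℕ} (Δ : ThetaRep T n) : Type
  | ofM (m : BrandtZero n) : ThetaUnion Δ
  | ofNonzero (t : T) (ht : t ≠ 0) : ThetaUnion Δ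

namespace ThetaUnion

variable {T : Type} [SemigroupWithZero T] {n : ℕ} {Δ : ThetaRep T n}

/-- The inclusion of `T`, sending its zero to `θ`. -/
def ofT [DecidableEq T] (t : T) : ThetaUnion Δ :=
  if ht : t = 0 then ofM .theta else ofNonzero t ht

/-- `(1; i, j) t = (1; i, Δ(t)(j))` if `Δ(t)(j) ≠ θ`, and `θ` otherwise. -/
def actRight (Δ : ThetaRep T n) : BrandtZero n → T → BrandtZero n
  | .theta, _ => .theta
  | .elt _ i j, t =>
    match Δ.toFun t (some j) with
    | some j' => .elt () i j'
    | none => .theta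

/-- `t (1; i, j) = (1; i', j)` if `Δ(t)(i') = i`, and `θ` if there is no such `i'`. -/
def actLeft (Δ : ThetaRep T n) : T → BrandtZero n → BrandtZero n
  | _, .theta => .theta
  | t, .elt _ i j =>
    match Δ.preimage t i with
    | some i' => .elt () i' j
    | none => .theta

/-- The multiplication extends those of `M` and of `T`. -/
def mul [DecidableEq T] : ThetaUnion Δ → ThetaUnion Δ → ThetaUnion Δ
  | ofM x, ofM y => ofM (x * y)
  | ofM x, ofNonzero t _ => ofM (actRight Δ x t)
  | ofNonzero t _, ofM x => ofM (actLeft Δ t x)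
  | ofNonzero s _, ofNonzero t _ => ofT (s * t)

instance [DecidableEq T] : Mul (ThetaUnion Δ) := ⟨mul⟩

theorem brandt_mul (i j k l : Fin n) :
    (.elt () i j : BrandtZero n) * .elt () k l = if j = k then .elt () i l else .theta := by
  rw [ReesZero.elt_mul_elt, Matrix.one_apply]
  split <;> rfl

theorem actRight_elt {t : T} {i j k : Fin n} (h : Δ.toFun t (some j) = some k) :
    actRight Δ (.elt () i j) t = .elt () i k := by simp [actRight, h]

theorem actRight_none {t : T} {i j : Fin n} (h : Δ.toFun t (some j) = none) :
    actRight Δ (.elt () i j) t = .theta := by simp [actRight, h]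

theorem actLeft_elt {t : T} {i j k : Fin n} (h : Δ.preimage t i = some k) :
    actLeft Δ t (.elt () i j) = .elt () k j := by simp [actLeft, h]

theorem actLeft_none {t : T} {i j : Fin n} (h : Δ.preimage t i = none) :
    actLeft Δ t (.elt () i j) = .theta := by simp [actLeft, h]

@[simp] theorem actRight_theta (t : T) : actRight Δ .theta t = .theta := rfl

@[simp] theorem actLeft_theta (t : T) : actLeft Δ t .theta = .theta := rfl

theorem toFun_zero (x : Option (Fin n)) : Δ.toFun 0 x = none := (Δ.eq_zero_iff 0).2 rfl x

theorem preimage_zero (i : Fin n) : Δ.preimage 0 i = none := by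
  rw [Option.eq_none_iff_forall_ne_some]
  intro k hk
  rw [Δ.preimage_eq_some, toFun_zero] at hk
  exact absurd hk (by simp)

theorem actRight_zero (x : BrandtZero n) : actRight Δ x 0 = .theta := by
  rcases x with _ | ⟨⟨⟩, i, j⟩
  · rfl
  · exact actRight_none (toFun_zero _)

theorem actLeft_zero (x : BrandtZero n) : actLeft Δ 0 x = .theta := by
  rcases x with _ | ⟨⟨⟩, i, j⟩
  · rfl
  · exact actLeft_none (preimage_zero _)

theorem mul_actRight (x y : BrandtZero n) (t : T) :
    actRight Δ (x * y) t = x * actRight Δ y t := by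
  rcases x with _ | ⟨⟨⟩, i, j⟩
  · rfl
  rcases y with _ | ⟨⟨⟩, k, l⟩
  · rfl
  cases h : Δ.toFun t (some l) with
  | none =>
    rw [actRight_none h, brandt_mul]
    split
    · rw [actRight_none h]; rfl
    · rfl
  | some m =>
    rw [actRight_elt h, brandt_mul, brandt_mul]
    split
    · rw [actRight_elt h]
    · rfl

theorem actLeft_mul (x y : BrandtZero n) (t : T) :
    actLeft Δ t (x * y) = actLeft Δ t x * y := by
  rcases x with _ | ⟨⟨⟩, i, j⟩
  · rfl
  rcases y with _ | ⟨⟨⟩, k, l⟩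
  · simp
  cases h : Δ.preimage t i with
  | none =>
    rw [actLeft_none h, brandt_mul]
    split
    · rw [actLeft_none h]; rfl
    · rfl
  | some m =>
    rw [actLeft_elt h, brandt_mul, brandt_mul]
    split
    · rw [actLeft_elt h]
    · rfl

theorem actRight_mul_eq (x y : BrandtZero n) (t : T) :
    actRight Δ x t * y = x * actLeft Δ t y := by
  rcases x with _ | ⟨⟨⟩, i, j⟩
  · rfl
  rcases y with _ | ⟨⟨⟩, k, l⟩
  · simp
  cases h : Δ.toFun t (some j) with
  | none =>
    rw [actRight_none h, ReesZero.theta_mul]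
    cases h' : Δ.preimage t k with
    | none => rw [actLeft_none h']; rfl
    | some m =>
      rw [actLeft_elt h', brandt_mul, if_neg]
      rintro rfl
      rw [Δ.preimage_eq_some, h] at h'
      exact absurd h' (by simp)
  | some m =>
    rw [actRight_elt h, brandt_mul]
    cases h' : Δ.preimage t k with
    | none =>
      rw [actLeft_none h', ReesZero.mul_theta, if_neg]
      rintro rfl
      rw [← Δ.preimage_eq_some, h'] at h
      exact absurd h (by simp)
    | some p =>
      rw [actLeft_elt h', brandt_mul]
      rw [Δ.preimage_eq_some] at h'
      congr 1
      refine propext ⟨?_, ?_⟩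
      · rintro rfl
        exact Option.some.inj (Δ.inj t _ _ (by simp [h]) (h.trans h'.symm))
      · rintro rfl
        exact Option.some.inj (h.symm.trans h')

theorem actRight_actRight (x : BrandtZero n) (s t : T) :
    actRight Δ (actRight Δ x s) t = actRight Δ x (s * t) := by
  rcases x with _ | ⟨⟨⟩, i, j⟩
  · rfl
  have hm := Δ.map_mul s t (some j)
  cases h : Δ.toFun s (some j) with
  | none =>
    rw [h, Δ.map_theta] at hm
    rw [actRight_none h, actRight_none hm]; rfl
  | some k =>
    rw [h] at hm
    rw [actRight_elt h]
    simp [actRight, hm]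

theorem actLeft_actLeft (x : BrandtZero n) (s t : T) :
    actLeft Δ s (actLeft Δ t x) = actLeft Δ (s * t) x := by
  rcases x with _ | ⟨⟨⟩, i, j⟩
  · rfl
  have key : Δ.preimage (s * t) i = (Δ.preimage t i).bind (Δ.preimage s) := by
    ext k
    rw [Δ.preimage_eq_some, Δ.map_mul, Option.bind_eq_some_iff]
    simp only [Δ.preimage_eq_some]
    constructor
    · intro h
      cases h' : Δ.toFun s (some k) with
      | none => rw [h', Δ.map_theta] at h; exact absurd h (by simp)
      | some m => exact ⟨m, h' ▸ h, rfl⟩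
    · rintro ⟨m, hm, hk⟩
      rw [hk, hm]
  cases h : Δ.preimage t i with
  | none =>
    rw [h] at key
    rw [actLeft_none h, actLeft_none key]; rfl
  | some k =>
    rw [h] at key
    rw [actLeft_elt h]
    simp [actLeft, key]

theorem actRight_actLeft (x : BrandtZero n) (s t : T) :
    actRight Δ (actLeft Δ s x) t = actLeft Δ s (actRight Δ x t) := by
  rcases x with _ | ⟨⟨⟩, i, j⟩
  · rfl
  cases h : Δ.preimage s i <;> cases h' : Δ.toFun t (some j) <;> simp [actLeft, actRight, h, h']

section

variable [DecidableEq T]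

theorem ofM_mul_ofM (x y : BrandtZero n) : (ofM x * ofM y : ThetaUnion Δ) = ofM (x * y) := rfl

theorem ofM_mul_ofT (x : BrandtZero n) (t : T) :
    (ofM x * ofT t : ThetaUnion Δ) = ofM (actRight Δ x t) := by
  unfold ofT
  split
  · next h => rw [h, actRight_zero, ofM_mul_ofM, ReesZero.mul_theta]
  · rfl

theorem ofT_mul_ofM (x : BrandtZero n) (t : T) :
    (ofT t * ofM x : ThetaUnion Δ) = ofM (actLeft Δ t x) := by
  unfold ofT
  split
  · next h => rw [h, actLeft_zero, ofM_mul_ofM, ReesZero.theta_mul]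
  · rfl

theorem ofT_mul_ofT (s t : T) : (ofT s * ofT t : ThetaUnion Δ) = ofT (s * t) := by
  by_cases hs : s = 0
  · subst hs
    simp only [zero_mul]
    rw [show (ofT 0 : ThetaUnion Δ) = ofM .theta from dif_pos rfl, ofM_mul_ofT]
    rfl
  by_cases ht : t = 0
  · subst ht
    simp only [mul_zero]
    rw [show (ofT 0 : ThetaUnion Δ) = ofM .theta from dif_pos rfl, ofT_mul_ofM]
    rfl
  rw [show (ofT s : ThetaUnion Δ) = ofNonzero s hs from dif_neg hs,
    show (ofT t : ThetaUnion Δ) = ofNonzero t ht from dif_neg ht]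
  rfl

theorem cases_ofM_ofT (x : ThetaUnion Δ) : (∃ m, x = ofM m) ∨ ∃ t, x = ofT t := by
  rcases x with m | ⟨t, ht⟩
  · exact Or.inl ⟨m, rfl⟩
  · exact Or.inr ⟨t, (dif_neg ht).symm⟩

end

instance [DecidableEq T] : Semigroup (ThetaUnion Δ) where
  mul_assoc x y z := by
    rcases cases_ofM_ofT x with ⟨x, rfl⟩ | ⟨x, rfl⟩ <;>
    rcases cases_ofM_ofT y with ⟨y, rfl⟩ | ⟨y, rfl⟩ <;>
    rcases cases_ofM_ofT z with ⟨z, rfl⟩ | ⟨z, rfl⟩ <;>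
    simp only [ofM_mul_ofM, ofM_mul_ofT, ofT_mul_ofM, ofT_mul_ofT, mul_assoc, mul_actRight,
      actLeft_mul, actRight_mul_eq, actRight_actRight, actLeft_actLeft, actRight_actLeft]

end ThetaUnion

/-- The cyclic group `{1, u}` of order `2` with a zero adjoined. -/
abbrev C2Zero : Type := WithZero (Multiplicative (ZMod 2))

instance : Fintype C2Zero := inferInstanceAs (Fintype (Option (Multiplicative (ZMod 2))))

/-- The transformations of `{1, 2} ∪ {θ}` (`1, 2` are the elements `0, 1` of `Fin 2`) with
`Γ(1) = (1)(2)`, `Γ(u) = (1,2)` and `Γ(θ)` constantly `θ`. -/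
def gammaFun (t : C2Zero) (x : Option (Fin 2)) : Option (Fin 2) :=
  if t = 0 then none else if t = 1 then x else x.map (Equiv.swap 0 1)

/-- The representation `Γ` of `{1, u, θ}`. -/
def Gamma : ThetaRep C2Zero 2 where
  toFun := gammaFun
  map_mul := by decide
  map_theta := by decide
  eq_zero_iff := by decide
  inj := by decide

/-- `F₇ = M⁰({1}, 2, 2; I₂) ∪^Γ {1, u, θ}`. -/
abbrev F7 : Type := ThetaUnion Gamma

/-- `S ≺ T`: the semigroup `S` is a homomorphic image of a subsemigroup of `T`. -/
def SemigroupDivides (S T : Type*) [Semigroup S] [Semigroup T] : Prop :=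
  ∃ (U : Subsemigroup T) (φ : U →ₙ* S), Function.Surjective φ

/-- A finite semigroup `S` is `×`-prime if `S ≺ T × V` implies `S ≺ T` or `S ≺ V` for all
finite semigroups `T` and `V`. -/
def IsTimesPrime.{w, u, v} (S : Type w) [Semigroup S] : Prop :=
  Finite S ∧
    ∀ (T : Type u) (V : Type v) [Semigroup T] [Semigroup V] [Finite T] [Finite V],
      SemigroupDivides S (T × V) → SemigroupDivides S T ∨ SemigroupDivides S V

universe u v

/-! Let `F7` divide `T × V`; adjoining identities, `T` and `V` may be taken to be monoids. There are
a lift `y` of `u` with `y ^ 2 ^ k` idempotent and an idempotent lift `f` of `(1; 1, 1)` with `f * y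
^ 2 ^ k = f`. The element `f * y * f` lifts `θ`. If both its coordinates were `𝓙`-above those of
`f`, they would lie in maximal subgroups and some power of `f * y * f` would be `f`, which does not
lift `θ`. Hence in one coordinate, say in `T`, `f * y * f` drops strictly below `f`.

In that coordinate, the set of `n` with `f * y ^ n * f` `𝓙`-above `f` has period `2 ^ k`, contains
`0` and omits `1`. By `exists_progression_iff_even` it meets some progression `s + d * n` exactly at
the even `n`. This parity pattern is the multiplication rule of `F7`: with `y ^ d` for `u` and `y ^
s` as a connecting factor, `graph` is a division of `T` by `F7`. It is single-valued because it
separates `θ` from the rest and the syntactic congruence of `{θ}` is trivial. -/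

/-! ### Powers and the `𝓙`-order in finite monoids. -/

theorem exists_pow_isIdempotentElem {M : Type*} [Monoid M] [Finite M] (x : M) :
    ∃ n, n ≠ 0 ∧ IsIdempotentElem (x ^ n) := by
  obtain ⟨i, j, hne, hij⟩ := Finite.exists_ne_map_eq_of_infinite fun n : ℕ => x ^ n
  wlog hlt : i < j generalizing i j
  · exact this j i hne.symm hij.symm (by omega)
  obtain ⟨p, rfl⟩ := Nat.exists_eq_add_of_lt hlt
  have hper : ∀ k l, x ^ (i + l + k * (p + 1)) = x ^ (i + l) := by
    intro k l
    induction k with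
    | zero => simp
    | succ k ih =>
      rw [← ih, show i + l + (k + 1) * (p + 1) = i + p + 1 + (l + k * (p + 1)) by ring, pow_add,
        ← hij, ← pow_add, add_assoc]
  refine ⟨(i + 1) * (p + 1), by positivity, ?_⟩
  have h := hper (i + 1) (i * p + p + 1)
  rw [show i + (i * p + p + 1) = (i + 1) * (p + 1) by ring] at h
  rwa [IsIdempotentElem, ← pow_add]

/-- A power of the first of two elements of a finite local monoid with product the identity
is the identity. -/
theorem pow_eq_of_mul_eq {M : Type*} [Monoid M] [Finite M] {f p q : M}
    (hpf : p * f = p) (hpq : p * q = f) : ∃ n, n ≠ 0 ∧ p ^ n = f := by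
  obtain ⟨n, hn, he⟩ := exists_pow_isIdempotentElem p
  refine ⟨n, hn, ?_⟩
  have hpow : ∀ k, p ^ (k + 1) * q ^ (k + 1) = f := by
    intro k
    induction k with
    | zero => simpa using hpq
    | succ k ih =>
      rw [pow_succ p, pow_succ' q, mul_assoc, ← mul_assoc p q, hpq, ← mul_assoc,
        pow_succ p, mul_assoc (p ^ k), hpf, ← pow_succ, ih]
  obtain ⟨k, rfl⟩ := Nat.exists_eq_succ_of_ne_zero hn
  have hf : p ^ (k + 1) * f = p ^ (k + 1) := by rw [pow_succ, mul_assoc, hpf]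
  -- With `P = p ^ (k + 1)` idempotent and `Q = q ^ (k + 1)`: `P = P f = P P Q = P Q = f`.
  rw [← hf]
  nth_rewrite 1 [← hpow k]
  rw [← mul_assoc, he.eq, hpow]

/-- `z` lies above `f` in the `𝓙`-order. -/
def JAbove {M : Type*} [Monoid M] (f z : M) : Prop := ∃ a b, a * z * b = f

section JAbove

variable {M : Type*} [Monoid M] {f z w h h' : M}

theorem JAbove.refl (f : M) : JAbove f f := ⟨1, 1, by simp⟩

theorem JAbove.of_mul_right (hz : JAbove f (z * w)) : JAbove f z := by
  obtain ⟨a, b, hab⟩ := hz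
  exact ⟨a, w * b, by simpa only [mul_assoc] using hab⟩

theorem JAbove.of_mul_left (hz : JAbove f (z * w)) : JAbove f w := by
  obtain ⟨a, b, hab⟩ := hz
  exact ⟨a * z, b, by simpa only [mul_assoc] using hab⟩

/-- An element of the local monoid at `f` that lies `𝓙`-above `f` lies in the maximal
subgroup at `f`. -/
theorem JAbove.exists_pow_eq [Finite M] (hf : f * f = f) (hl : f * h = h) (hr : h * f = h)
    (hh : JAbove f h) : ∃ n, n ≠ 0 ∧ h ^ n = f := by
  obtain ⟨a, b, hab⟩ := hh
  have hpq : (f * a * f) * (h * b * f) = f := by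
    calc (f * a * f) * (h * b * f) = f * (a * (f * h) * b) * f := by simp only [mul_assoc]
      _ = f := by rw [hl, hab, hf, hf]
  obtain ⟨n, hn, hpow⟩ := pow_eq_of_mul_eq (f := f) (by rw [mul_assoc, hf]) hpq
  obtain ⟨k, rfl⟩ := Nat.exists_eq_succ_of_ne_zero hn
  -- `f * a * f` is a left inverse of `h * b * f` and has `f` as a power, so it is also a right
  -- inverse; this gives a right inverse of `h`.
  refine pow_eq_of_mul_eq (q := b * f * (f * a * f)) hr ?_
  have hfp : f * (f * a * f) = f * a * f := by simp only [← mul_assoc, hf]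
  calc h * (b * f * (f * a * f)) = (f * h) * b * f * (f * a * f) := by rw [hl]; simp only [mul_assoc]
    _ = (f * a * f) ^ (k + 1) * (h * b * f) * (f * a * f) := by
      rw [hpow]; simp only [mul_assoc]
    _ = (f * a * f) ^ k * (((f * a * f) * (h * b * f)) * (f * a * f)) := by
      rw [pow_succ]; simp only [mul_assoc]
    _ = f := by rw [hpq, hfp, ← pow_succ, hpow]

/-- `h` is invertible in the local monoid at `f`, so a left multiple of `h * h'` is `h'` again. -/
theorem JAbove.mul_of_local_left [Finite M] (hf : f * f = f) (hl : f * h = h) (hr : h * f = h)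
    (hh : JAbove f h) (hl' : f * h' = h') (hh' : JAbove f h') : JAbove f (h * h') := by
  obtain ⟨n, hn, hpow⟩ := hh.exists_pow_eq hf hl hr
  obtain ⟨k, rfl⟩ := Nat.exists_eq_succ_of_ne_zero hn
  refine JAbove.of_mul_left (z := h ^ k) ?_
  rwa [← mul_assoc, ← pow_succ, hpow, hl']

end JAbove

/-! ### Divisions as single-valued, surjective relations. -/

theorem SemigroupDivides.of_relation {S T : Type*} [Semigroup S] [Semigroup T]
    (R : Subsemigroup (T × S)) (hfun : ∀ t s s', (t, s) ∈ R → (t, s') ∈ R → s = s')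
    (hsurj : ∀ s, ∃ t, (t, s) ∈ R) : SemigroupDivides S T := by
  have hex : ∀ t : R.map (MulHom.fst T S), ∃ s, (t.1, s) ∈ R := by
    rintro ⟨_, ⟨t, s⟩, h, rfl⟩
    exact ⟨s, h⟩
  choose φ hφ using hex
  refine ⟨R.map (MulHom.fst T S), ⟨φ, fun t t' => ?_⟩, fun s => ?_⟩
  · exact hfun _ _ _ (hφ (t * t')) (R.mul_mem (hφ t) (hφ t'))
  · obtain ⟨t, ht⟩ := hsurj s
    exact ⟨⟨t, (t, s), ht, rfl⟩, hfun _ _ _ (hφ ⟨t, (t, s), ht, rfl⟩) ht⟩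

theorem SemigroupDivides.exists_relation {S T : Type*} [Semigroup S] [Semigroup T]
    (h : SemigroupDivides S T) : ∃ R : Subsemigroup (T × S),
      (∀ t s s', (t, s) ∈ R → (t, s') ∈ R → s = s') ∧ ∀ s, ∃ t, (t, s) ∈ R := by
  obtain ⟨U, φ, hφ⟩ := h
  refine ⟨⟨{p | ∃ h : p.1 ∈ U, φ ⟨p.1, h⟩ = p.2}, ?_⟩, ?_, ?_⟩
  · rintro ⟨a, s⟩ ⟨b, s'⟩ ⟨ha, hs⟩ ⟨hb, hs'⟩
    exact ⟨U.mul_mem ha hb, (map_mul φ ⟨a, ha⟩ ⟨b, hb⟩).trans (congrArg₂ _ hs hs')⟩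
  · rintro t s s' ⟨_, hs⟩ ⟨_, hs'⟩
    exact hs.symm.trans hs'
  · intro s
    obtain ⟨⟨t, ht⟩, rfl⟩ := hφ s
    exact ⟨t, ht, rfl⟩

theorem SemigroupDivides.of_injective {S T T' : Type*} [Semigroup S] [Semigroup T] [Semigroup T']
    (f : T →ₙ* T') (hf : Function.Injective f) (h : SemigroupDivides S T) :
    SemigroupDivides S T' := by
  obtain ⟨R, hfun, hsurj⟩ := h.exists_relation
  refine .of_relation (R.map (f.prodMap (MulHom.id S))) ?_ ?_
  · rintro _ _ _ ⟨⟨t, s⟩, h, ⟨⟩⟩ ⟨⟨t', s'⟩, h', he⟩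
    obtain ⟨ht, rfl⟩ := Prod.ext_iff.1 he
    obtain rfl : t' = t := hf ht
    exact hfun _ _ _ h h'
  · intro s
    obtain ⟨t, ht⟩ := hsurj s
    exact ⟨f t, (t, s), ht, rfl⟩

theorem Subsemigroup.pow_mem_of_ne_zero {M : Type*} [Monoid M] (R : Subsemigroup M) {x : M}
    (hx : x ∈ R) {n : ℕ} (hn : n ≠ 0) : x ^ n ∈ R := by
  obtain ⟨k, rfl⟩ := Nat.exists_eq_succ_of_ne_zero hn
  induction k with
  | zero => simpa using hx
  | succ k ih => rw [pow_succ]; exact R.mul_mem (ih (by omega)) hx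

/-! ### Periodic sets of period a power of two. -/

/-- Some coset of a subgroup of a cyclic `2`-group meets a given proper nonempty subset in
exactly one of the two cosets of the subgroup of index `2`. -/
theorem exists_progression_iff_even (k : ℕ) (C : ℕ → Prop) (hper : ∀ n, C (n + 2 ^ k) ↔ C n)
    {i j : ℕ} (hi : C i) (hj : ¬ C j) : ∃ s d, ∀ n, C (s + d * n) ↔ Even n := by
  induction k generalizing C i j with
  | zero =>
    have hall : ∀ n, C n ↔ C 0 := by
      intro n
      induction n with
      | zero => rfl
      | succ n ih => rw [← ih]; exact hper n
    exact absurd ((hall j).2 ((hall i).1 hi)) hj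
  | succ k ih =>
    by_contra hno
    -- A residue class mod `2` on which `C` is not constant has period `2 ^ k` after rescaling, so
    -- the induction hypothesis yields a progression inside it. Otherwise `C` depends on parity
    -- alone, and `d = 1` works.
    have hconst : ∀ r a b, C (2 * a + r) → C (2 * b + r) := by
      intro r a b ha
      by_contra hb
      obtain ⟨s, d, hsd⟩ := ih (fun n => C (2 * n + r)) (fun n => by
        rw [← hper (2 * n + r), pow_succ]; ring_nf) ha hb
      refine hno ⟨2 * s + r, 2 * d, fun n => ?_⟩
      rw [← hsd]
      ring_nf
    have heven : ∀ n r, C (2 * n + r) ↔ C r := fun n r => by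
      simpa using (⟨hconst r n 0, hconst r 0 n⟩ : _ ↔ _)
    have hpar : ∀ n, C n ↔ C (n % 2) := fun n => by
      rw [← heven (n / 2) (n % 2), Nat.div_add_mod]
    rw [hpar] at hi hj
    rcases Nat.mod_two_eq_zero_or_one i with h | h <;>
      rcases Nat.mod_two_eq_zero_or_one j with h' | h' <;> rw [h] at hi <;> rw [h'] at hj
    · exact hj hi
    · refine hno ⟨0, 1, fun n => ?_⟩
      rw [hpar, Nat.even_iff]
      rcases Nat.mod_two_eq_zero_or_one n with hn | hn <;> simp [hn, hi, hj]
    · refine hno ⟨1, 1, fun n => ?_⟩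
      rw [hpar, Nat.even_iff]
      rcases Nat.mod_two_eq_zero_or_one n with hn | hn <;> simp [Nat.add_mod, hn, hi, hj]
    · exact hj hi

/-! ### Coordinates on `F7`, with indices in `ZMod 2` so that `u` acts by adding `1`. -/

namespace F7

/-- The elements `1 = unit 0` and `u = unit 1` of `F₇`. -/
def unit (c : ZMod 2) : F7 :=
  .ofNonzero ((Multiplicative.ofAdd c : Multiplicative (ZMod 2)) : C2Zero) WithZero.coe_ne_zero

/-- The element `(1; i, j)` of `F₇`. -/
def rankOne (i j : ZMod 2) : F7 := .ofM (.elt () (i : Fin 2) (j : Fin 2))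

/-- The zero of `F₇`. -/
def theta : F7 := .ofM .theta

theorem cases_eq (w : F7) :
    (∃ c, w = unit c) ∨ (∃ i j, w = rankOne i j) ∨ w = theta := by
  rcases w with (_ | ⟨⟨⟩, i, j⟩) | ⟨t, ht⟩
  · exact .inr (.inr rfl)
  · exact .inr (.inl ⟨i, j, rfl⟩)
  · obtain ⟨c, rfl⟩ := WithZero.ne_zero_iff_exists.1 ht
    exact .inl ⟨c.toAdd, rfl⟩

@[simp] theorem unit_ne_theta (c : ZMod 2) : unit c ≠ theta := nofun

@[simp] theorem rankOne_ne_theta (i j : ZMod 2) : rankOne i j ≠ theta := nofun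

@[simp] theorem unit_ne_rankOne (c i j : ZMod 2) : unit c ≠ rankOne i j := nofun

theorem unit_injective : Function.Injective unit := fun _ _ h =>
  WithZero.coe_injective (ThetaUnion.ofNonzero.inj h)

theorem rankOne_inj {i j k l : ZMod 2} : rankOne i j = rankOne k l ↔ i = k ∧ j = l := by
  constructor
  · intro h
    injection h with h
    injection h with _ hi hj
    exact ⟨hi, hj⟩
  · rintro ⟨rfl, rfl⟩
    rfl

@[simp] theorem theta_mul (w : F7) : theta * w = theta := by
  rcases w with m | ⟨t, ht⟩ <;> rfl

@[simp] theorem mul_theta (w : F7) : w * theta = theta := by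
  rcases w with m | ⟨t, ht⟩
  · exact congrArg ThetaUnion.ofM (ReesZero.mul_theta m)
  · rfl

@[simp] theorem unit_mul_unit (c d : ZMod 2) : unit c * unit d = unit (c + d) := rfl

@[simp] theorem unit_mul_rankOne (c i j : ZMod 2) :
    unit c * rankOne i j = rankOne (c + i) j := by
  fin_cases c <;> fin_cases i <;> rfl

@[simp] theorem rankOne_mul_unit (c i j : ZMod 2) :
    rankOne i j * unit c = rankOne i (j + c) := by
  fin_cases c <;> fin_cases j <;> rfl

theorem rankOne_mul_rankOne (i j k l : ZMod 2) :
    rankOne i j * rankOne k l = if j = k then rankOne i l else theta := by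
  fin_cases j <;> fin_cases k <;> rfl

theorem unit_zero_mul (w : F7) : unit 0 * w = w := by
  obtain ⟨c, rfl⟩ | ⟨i, j, rfl⟩ | rfl := cases_eq w <;> simp

theorem mul_unit_zero (w : F7) : w * unit 0 = w := by
  obtain ⟨c, rfl⟩ | ⟨i, j, rfl⟩ | rfl := cases_eq w <;> simp

instance : Monoid F7 where
  one := unit 0
  one_mul := unit_zero_mul
  mul_one := mul_unit_zero

theorem unit_zero : unit 0 = 1 := rfl

theorem unit_one_pow (n : ℕ) : unit 1 ^ n = unit n := by
  induction n with
  | zero => rfl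
  | succ n ih => rw [pow_succ, ih, unit_mul_unit, Nat.cast_succ]

theorem isIdempotentElem_rankOne : IsIdempotentElem (rankOne 0 0) := by
  rw [IsIdempotentElem, rankOne_mul_rankOne, if_pos rfl]

theorem card_eq : Nat.card F7 = 7 := by
  let g : Option (ZMod 2 ⊕ ZMod 2 × ZMod 2) → F7 := fun
    | none => theta
    | some (.inl c) => unit c
    | some (.inr p) => rankOne p.1 p.2
  have hg : Function.Bijective g := by
    constructor
    · rintro (_ | c | ⟨i, j⟩) (_ | c' | ⟨i', j'⟩) h
      · rfl
      · exact absurd h.symm (unit_ne_theta _)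
      · exact absurd h.symm (rankOne_ne_theta _ _)
      · exact absurd h (unit_ne_theta _)
      · rw [unit_injective h]
      · exact absurd h (unit_ne_rankOne _ _ _)
      · exact absurd h (rankOne_ne_theta _ _)
      · exact absurd h.symm (unit_ne_rankOne _ _ _)
      · obtain ⟨rfl, rfl⟩ := rankOne_inj.1 h
        rfl
    · intro w
      obtain ⟨c, rfl⟩ | ⟨i, j, rfl⟩ | rfl := cases_eq w
      exacts [⟨some (.inl c), rfl⟩, ⟨some (.inr (i, j)), rfl⟩, ⟨none, rfl⟩]
  rw [← Nat.card_congr (Equiv.ofBijective g hg)]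
  simp [Nat.card_eq_fintype_card]

instance : Finite F7 := Nat.finite_of_card_ne_zero (by simp [card_eq])

/-- The syntactic congruence of the subset `{θ}` of `F₇` is trivial. -/
theorem eq_of_forall_mul_mul_eq_theta {w w' : F7}
    (h : ∀ c d, c * w * d = theta ↔ c * w' * d = theta) : w = w' := by
  -- With `F7` viewed as `2 × 2` zero-one matrices (two permutation matrices, four matrix units and
  -- zero), this tests whether entry `(i, j)` vanishes.
  have h' : ∀ i j, rankOne 0 i * w * rankOne j 0 = theta ↔
      rankOne 0 i * w' * rankOne j 0 = theta := fun i j => h _ _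
  have hunit : ∀ c i j, rankOne 0 i * unit c * rankOne j 0 = theta ↔ i + c ≠ j := by
    simp [rankOne_mul_rankOne]
  have hrank : ∀ k l i j, rankOne 0 i * rankOne k l * rankOne j 0 = theta ↔
      ¬ (i = k ∧ l = j) := by
    intro k l i j
    by_cases hk : i = k <;> by_cases hl : l = j <;> simp [rankOne_mul_rankOne, hk, hl]
  have hzero : ∀ i j, rankOne 0 i * theta * rankOne j 0 = theta ↔ True := by simp
  obtain ⟨c, rfl⟩ | ⟨i, j, rfl⟩ | rfl := cases_eq w <;>
    obtain ⟨c', rfl⟩ | ⟨i', j', rfl⟩ | rfl := cases_eq w' <;>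
    simp only [hunit, hrank, hzero] at h' <;> clear h hunit hrank hzero
  · congr 1
    revert c c'
    decide
  · exfalso
    revert c i' j'
    decide
  · exfalso
    revert c
    decide
  · exfalso
    revert c' i j
    decide
  · refine rankOne_inj.2 ?_
    revert i j i' j'
    decide
  · exfalso
    revert i j
    decide
  · exfalso
    revert c'
    decide
  · exfalso
    revert i' j'
    decide
  · rfl

/-- A relation between `T` and `F₇` that distinguishes `θ` from the other elements is a
homomorphism. -/
theorem divides_of_relation {T : Type*} [Semigroup T] (R : Subsemigroup (T × F7)) (Z : Set T)
    (hZ : ∀ t w, (t, w) ∈ R → (t ∈ Z ↔ w = theta)) (hsurj : ∀ w, ∃ t, (t, w) ∈ R) :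
    SemigroupDivides F7 T := by
  refine .of_relation R (fun t w w' h h' => eq_of_forall_mul_mul_eq_theta fun c d => ?_) hsurj
  obtain ⟨p, hp⟩ := hsurj c
  obtain ⟨q, hq⟩ := hsurj d
  exact (hZ _ _ (R.mul_mem (R.mul_mem hp h) hq)).symm.trans (hZ _ _ (R.mul_mem (R.mul_mem hp h') hq))

/-! ### A division by `F7` from a parity pattern. -/

section

variable {T : Type*} [Monoid T] {f y g : T}

/-- The graph of the homomorphism onto `F₇` with `y ↦ u` and `g h ↦ (1; 1, 1)` for the elements
`h` of the maximal subgroup at `f`. -/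
def graph (f y g : T) : Set (T × F7) :=
  {p | (∃ m : ℕ, p = (y ^ m, unit m)) ∨
    (∃ (h : T) (m n : ℕ), f * h = h ∧ h * f = h ∧ JAbove f h ∧
      p = (y ^ m * g * h * y ^ n, rankOne m n)) ∨
    (¬ JAbove f p.1 ∧ p.2 = theta)}

variable [Finite T] (hf : f * f = f) (hC : ∀ n : ℕ, JAbove f (f * y ^ n * g * f) ↔ Even n)

-- The case of substance is a product of two rank-one lifts. Its middle factor `f * y ^ (n + m') * g
-- * f` lies in the maximal subgroup at `f` when `n + m'` is even, that is, when the inner indices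
-- agree, and otherwise forces the product out of the elements `𝓙`-above `f`.
include hf hC in
theorem graph_mul_mem {p q : T × F7} (hp : p ∈ graph f y g) (hq : q ∈ graph f y g) :
    p * q ∈ graph f y g := by
  by_cases hp3 : ¬ JAbove f p.1 ∧ p.2 = theta
  · exact .inr (.inr ⟨fun h => hp3.1 h.of_mul_right, by simp [hp3.2]⟩)
  by_cases hq3 : ¬ JAbove f q.1 ∧ q.2 = theta
  · exact .inr (.inr ⟨fun h => hq3.1 h.of_mul_left, by simp [hq3.2]⟩)
  rcases hp with ⟨m, rfl⟩ | ⟨h, m, n, hl, hr, hJ, rfl⟩ | hp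
  · rcases hq with ⟨m', rfl⟩ | ⟨h', m', n', hl', hr', hJ', rfl⟩ | hq
    · exact .inl ⟨m + m', by simp [pow_add]⟩
    · exact .inr (.inl ⟨h', m + m', n', hl', hr', hJ', by simp [pow_add, mul_assoc]⟩)
    · exact absurd hq hq3
  · rcases hq with ⟨m', rfl⟩ | ⟨h', m', n', hl', hr', hJ', rfl⟩ | hq
    · exact .inr (.inl ⟨h, m, n + m', hl, hr, hJ, by simp [pow_add, mul_assoc]⟩)
    · have key : (y ^ m * g * h * y ^ n) * (y ^ m' * g * h' * y ^ n') =
          y ^ m * g * (h * (f * y ^ (n + m') * g * f) * h') * y ^ n' := by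
        calc _ = y ^ m * g * (h * f) * y ^ n * (y ^ m' * g * (f * h') * y ^ n') := by rw [hl', hr]
          _ = _ := by simp only [pow_add, mul_assoc]
      have hpar : (n : ZMod 2) = m' ↔ Even (n + m') := by
        rw [← ZMod.natCast_eq_zero_iff_even, Nat.cast_add]
        generalize (n : ZMod 2) = a
        generalize (m' : ZMod 2) = b
        revert a b
        decide
      by_cases he : Even (n + m')
      · refine .inr (.inl ⟨h * (f * y ^ (n + m') * g * f) * h', m, n', ?_, ?_, ?_, ?_⟩)
        · simp only [← mul_assoc, hl]
        · rw [mul_assoc, hr']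
        · refine .mul_of_local_left hf (by simp only [← mul_assoc, hl])
            (by simp only [mul_assoc, hf]) ?_ hl' hJ'
          exact .mul_of_local_left hf hl hr hJ (by simp only [← mul_assoc, hf]) ((hC _).2 he)
        · rw [Prod.mk_mul_mk, key, rankOne_mul_rankOne, if_pos (hpar.2 he)]
      · refine .inr (.inr ⟨fun hJ => he ?_, ?_⟩)
        · rw [Prod.mk_mul_mk, key] at hJ
          exact (hC _).1 hJ.of_mul_right.of_mul_left.of_mul_right.of_mul_left
        · rw [Prod.mk_mul_mk, rankOne_mul_rankOne, if_neg fun h => he (hpar.1 h)]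
    · exact absurd hq hq3
  · exact absurd hp hp3

include hf hC in
theorem graph_jAbove {t : T} {w : F7} (h : (t, w) ∈ graph f y g) :
    ¬ JAbove f t ↔ w = theta := by
  rcases h with ⟨m, he⟩ | ⟨h, m, n, hl, hr, hJ, he⟩ | ⟨hJ, he⟩
  · obtain ⟨rfl, rfl⟩ := Prod.mk.inj he
    have hm : JAbove f (y ^ m) := by
      have h := ((hC (m + m)).2 (Even.add_self m)).of_mul_right.of_mul_right.of_mul_left
      rw [pow_add] at h
      exact h.of_mul_right
    simp [hm]
  · obtain ⟨rfl, rfl⟩ := Prod.mk.inj he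
    have hg : JAbove f (y ^ m * g * h * y ^ n) := by
      -- Multiplying by `f * y ^ m` on the left and `y ^ n * g * f` on the right makes both
      -- exponents even, which leaves a product of elements of the maximal subgroup at `f`.
      have h1 : JAbove f (f * y ^ (m + m) * g * f * (h * (f * y ^ (n + n) * g * f))) := by
        refine .mul_of_local_left hf (by simp only [← mul_assoc, hf]) (by simp only [mul_assoc, hf])
          ((hC _).2 (Even.add_self m)) (by simp only [← mul_assoc, hl]) ?_
        exact .mul_of_local_left hf hl hr hJ (by simp only [← mul_assoc, hf])
          ((hC _).2 (Even.add_self n))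
      refine JAbove.of_mul_right (w := y ^ n * g * f) (.of_mul_left (z := f * y ^ m) ?_)
      convert h1 using 1
      calc _ = f * y ^ m * (y ^ m * g * (f * h * f) * y ^ n * (y ^ n * g * f)) := by rw [hl, hr]
        _ = _ := by simp only [pow_add, mul_assoc]
    simp [hg]
  · exact iff_of_true hJ he

include hf hC in
theorem divides_of_even : SemigroupDivides F7 T := by
  refine divides_of_relation ⟨graph f y g, graph_mul_mem hf hC⟩ {t | ¬ JAbove f t}
    (fun t w h => graph_jAbove hf hC h) fun w => ?_
  have hcast : ∀ c : ZMod 2, ((c.val : ℕ) : ZMod 2) = c := fun c => ZMod.natCast_zmod_val c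
  obtain ⟨c, rfl⟩ | ⟨i, j, rfl⟩ | rfl := cases_eq w
  · exact ⟨y ^ c.val, .inl ⟨c.val, by rw [hcast]⟩⟩
  · exact ⟨_, .inr (.inl ⟨f, i.val, j.val, hf, hf, .refl f, by rw [hcast, hcast]⟩)⟩
  -- The lift of `θ` is `f * y ^ 1 * g * f`, whose exponent is odd.
  · exact ⟨_, .inr (.inr ⟨fun h => absurd ((hC 1).1 h) (by decide), rfl⟩)⟩

end

/-! ### Choosing the coordinate, and removing the adjoined identities. -/

theorem divides_of_not_jAbove {T : Type*} [Monoid T] [Finite T] {f x : T} (hf : f * f = f)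
    {k : ℕ} (hx : f * x ^ 2 ^ k = f) (hJ : ¬ JAbove f (f * x * f)) : SemigroupDivides F7 T := by
  obtain ⟨s, d, h⟩ := exists_progression_iff_even k (fun n => JAbove f (f * x ^ n * f))
    (fun n => by rw [add_comm n, pow_add, ← mul_assoc, hx]) (i := 0) (j := 1)
    (by simpa [hf] using JAbove.refl f) (by simpa using hJ)
  refine divides_of_even (f := f) (y := x ^ d) (g := x ^ s) hf fun n => ?_
  rw [← h, add_comm, pow_add, pow_mul, ← mul_assoc]

theorem divides_or_of_divides_prod {T V : Type*} [Monoid T] [Monoid V] [Finite T] [Finite V]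
    (h : SemigroupDivides F7 (T × V)) : SemigroupDivides F7 T ∨ SemigroupDivides F7 V := by
  obtain ⟨R, hfun, hsurj⟩ := h.exists_relation
  obtain ⟨x, hx⟩ := hsurj (unit 1)
  obtain ⟨g, hg⟩ := hsurj (rankOne 0 0)
  obtain ⟨N, hN, hid⟩ := exists_pow_isIdempotentElem (x, unit 1)
  -- The odd part `m` of the exponent is absorbed into the lift: `x ^ m` still lifts `u`, and its `2
  -- ^ k`-th power is idempotent.
  obtain ⟨k, m, hm, rfl⟩ := Nat.exists_eq_two_pow_mul_odd hN
  have hy : (x ^ m, unit 1) ∈ R := by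
    have := R.pow_mem_of_ne_zero hx hm.pos.ne'
    rwa [Prod.pow_mk, unit_one_pow, (ZMod.natCast_eq_one_iff_odd).2 hm] at this
  rw [mul_comm, pow_mul] at hid
  have he := R.pow_mem_of_ne_zero hx hN
  rw [mul_comm, pow_mul, Prod.pow_mk x (unit 1) m, Prod.pow_mk (x ^ m)] at he
  rw [Prod.pow_mk x (unit 1) m, Prod.pow_mk (x ^ m)] at hid
  generalize x ^ m = y at *
  have hid1 : y ^ 2 ^ k * y ^ 2 ^ k = y ^ 2 ^ k := congrArg Prod.fst hid
  have hid2 : (unit 1 ^ m) ^ 2 ^ k = 1 := by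
    have h2 : (unit 1 ^ m) ^ 2 ^ k * (unit 1 ^ m) ^ 2 ^ k = (unit 1 ^ m) ^ 2 ^ k :=
      congrArg Prod.snd hid
    rw [← pow_mul, unit_one_pow] at h2 ⊢
    rw [unit_mul_unit] at h2
    rw [← unit_zero, add_eq_left.1 (unit_injective h2)]
  rw [hid2] at he
  -- Flanking `g` by the idempotent `y ^ 2 ^ k`, a lift of `1`, makes the resulting `f` absorb it.
  obtain ⟨M, hM, hfid⟩ := exists_pow_isIdempotentElem (y ^ 2 ^ k * g * y ^ 2 ^ k)
  obtain ⟨L, rfl⟩ := Nat.exists_eq_succ_of_ne_zero hM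
  have hfR := R.pow_mem_of_ne_zero (R.mul_mem (R.mul_mem he hg) he) hM
  simp only [Prod.mk_mul_mk, one_mul, mul_one, Prod.pow_mk,
    isIdempotentElem_rankOne.pow_succ_eq] at hfR
  have hfe : (y ^ 2 ^ k * g * y ^ 2 ^ k) ^ (L + 1) * y ^ 2 ^ k =
      (y ^ 2 ^ k * g * y ^ 2 ^ k) ^ (L + 1) := by
    rw [pow_succ, mul_assoc, mul_assoc _ (y ^ 2 ^ k) (y ^ 2 ^ k), hid1]
  generalize (y ^ 2 ^ k * g * y ^ 2 ^ k) ^ (L + 1) = f at *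
  have hf1 : f.1 * f.1 = f.1 := congrArg Prod.fst hfid
  have hf2 : f.2 * f.2 = f.2 := congrArg Prod.snd hfid
  by_cases h1 : JAbove f.1 (f.1 * y.1 * f.1)
  swap
  · exact .inl (divides_of_not_jAbove hf1 (congrArg Prod.fst hfe) h1)
  by_cases h2 : JAbove f.2 (f.2 * y.2 * f.2)
  swap
  · exact .inr (divides_of_not_jAbove hf2 (congrArg Prod.snd hfe) h2)
  obtain ⟨a, ha, hpa⟩ := h1.exists_pow_eq hf1 (by simp only [← mul_assoc, hf1])
    (by simp only [mul_assoc, hf1])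
  obtain ⟨b, hb, hpb⟩ := h2.exists_pow_eq hf2 (by simp only [← mul_assoc, hf2])
    (by simp only [mul_assoc, hf2])
  -- The exponent `a * b` serves both coordinates at once.
  have hpow : (f * y * f) ^ (a * b) = f := by
    have hb1 : f.1 ^ b = f.1 := by
      obtain ⟨c, rfl⟩ := Nat.exists_eq_succ_of_ne_zero hb
      exact IsIdempotentElem.pow_succ_eq c hf1
    have ha2 : f.2 ^ a = f.2 := by
      obtain ⟨c, rfl⟩ := Nat.exists_eq_succ_of_ne_zero ha
      exact IsIdempotentElem.pow_succ_eq c hf2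
    refine Prod.ext ?_ ?_
    · change (f.1 * y.1 * f.1) ^ (a * b) = f.1
      rw [pow_mul, hpa, hb1]
    · change (f.2 * y.2 * f.2) ^ (a * b) = f.2
      rw [mul_comm, pow_mul, hpb, ha2]
  have hmem := R.pow_mem_of_ne_zero (R.mul_mem (R.mul_mem hfR hy) hfR) (mul_ne_zero ha hb)
  have hzero : rankOne 0 0 * unit 1 * rankOne 0 0 = theta := by
    rw [rankOne_mul_unit, rankOne_mul_rankOne, if_neg (by decide)]
  obtain ⟨c, hc⟩ := Nat.exists_eq_succ_of_ne_zero (mul_ne_zero ha hb)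
  have hid : IsIdempotentElem theta := theta_mul theta
  rw [Prod.mk_mul_mk f y, Prod.mk_mul_mk (f * y), hzero, Prod.pow_mk (f * y * f), hpow, hc, hid.pow_succ_eq] at hmem
  exact absurd (hfun _ _ _ hfR hmem) (rankOne_ne_theta 0 0)

/-- The adjoined identity can only lift `unit 0`, and `unit 0` is also lifted by the square of a
lift of `u`, so the adjoined identity is dispensable. -/
theorem divides_of_divides_withOne {T : Type*} [Semigroup T]
    (h : SemigroupDivides F7 (WithOne T)) : SemigroupDivides F7 T := by
  obtain ⟨R, hfun, hsurj⟩ := h.exists_relation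
  have hone : ∀ w, ((1 : WithOne T), w) ∈ R → w = unit 0 := by
    intro w hw
    obtain ⟨t, ht⟩ := hsurj (unit 0)
    have h := R.mul_mem hw ht
    rw [Prod.mk_mul_mk, one_mul, mul_unit_zero] at h
    exact hfun _ _ _ h ht
  have hcoe : ∀ w, w ≠ unit 0 → ∃ t : T, ((t : WithOne T), w) ∈ R := by
    intro w hw
    obtain ⟨t, ht⟩ := hsurj w
    cases t with
    | one => exact absurd (hone w ht) hw
    | coe t => exact ⟨t, ht⟩
  refine .of_relation (R.comap (WithOne.coeMulHom.prodMap (MulHom.id F7)))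
    (fun t w w' h h' => hfun _ _ _ h h') fun w => ?_
  by_cases hw : w = unit 0
  · obtain ⟨t, ht⟩ := hcoe (unit 1) fun h => absurd (unit_injective h) (by decide)
    refine ⟨t * t, ?_⟩
    rw [hw]
    exact R.mul_mem ht ht
  · exact hcoe w hw

end F7

theorem mainTheorem3 : Nat.card F7 = 7 ∧ IsTimesPrime.{0, u, v} F7 := by
  refine ⟨F7.card_eq, inferInstance, fun T V _ _ _ _ h => ?_⟩
  have hinj : Function.Injective
      ((WithOne.coeMulHom (α := T)).prodMap (WithOne.coeMulHom (α := V))) :=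
    WithOne.coe_injective.prodMap WithOne.coe_injective
  have : Finite (WithOne T) := inferInstanceAs (Finite (Option T))
  have : Finite (WithOne V) := inferInstanceAs (Finite (Option V))
  exact (F7.divides_or_of_divides_prod (h.of_injective _ hinj)).imp
    F7.divides_of_divides_withOne F7.divides_of_divides_withOne
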